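/- Let $K$ be a field and let $I\subset S=K[x_1,x_2]$ be a nonzero monomial ideal whose unique minimal set of monomial generators is $\mathcal{G}(I)=\{u_1,\dots,u_m\}$ $(m\ge 1)$, where $\deg_{x_1}(u_1)<\deg_{x_1}(u_2)<\cdots<\deg_{x_1}(u_m)$ and $\deg_{x_1}(u_i)+\deg_{x_2}(u_i)=d$ for every $1\le i\le m$. Let $\operatorname{reg}(I)=\max\{j-i \mid \beta_{i,j}(I)\neq 0\}$ be the Castelnuovo–Mumford regularity of $I$, where $\beta_{i,j}(I)$ is the number of summands $S(-j)$ in homological degree $i$ of the minimal graded free resolution of $I$. Then (1) $\operatorname{reg}(I)=d$ if and only if $m=1$, or $m\ge 2$ and $\deg_{x_1}(u_{i+1})-\deg_{x_1}(u_i)=1$ for every $1\le i\le m-1$; (2) $\operatorname{reg}(I)=d$ if and only if $I$ has linear quotients, that is, there is an ordering $v_1,\dots,v_m$ of $\mathcal{G}(I)$ such that for each $1\le i\le m-1$ the colon ideal $(v_1,\dots,v_i):v_{i+1}$ is generated by a subset of the variables $\{x_1,x_2\}$. -/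

import Mathlib

noncomputable section

/-- An ideal of `K[x_s : s ∈ σ]` is a monomial ideal if it is generated by monomials. -/
def IsMonomialIdeal {σ K : Type*} [Field K] (I : Ideal (MvPolynomial σ K)) : Prop :=
  ∃ A : Set (σ →₀ ℕ), I = Ideal.span ((fun a => MvPolynomial.monomial a (1 : K)) '' A)

/-- The exponent vectors of `𝒢(I)`, the minimal monomial generators of a monomial ideal `I`:
the monomials in `I` that are minimal with respect to divisibility. -/
def minimalMonomialGenerators {σ K : Type*} [Field K] (I : Ideal (MvPolynomial σ K)) :
    Set (σ →₀ ℕ) :=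
  {a | Minimal (fun b => MvPolynomial.monomial b (1 : K) ∈ I) a}

/-- `I` has linear quotients: there is an ordering `v 0, …, v (m - 1)` of `𝒢(I)` such that each
colon ideal `(v 0, …, v (i - 1)) : v i`, for `0 < i < m`, is generated by a subset of the
variables. -/
def HasLinearQuotients {σ K : Type*} [Field K] (I : Ideal (MvPolynomial σ K)) : Prop :=
  ∃ (m : ℕ) (v : Fin m → (σ →₀ ℕ)),
    Function.Injective v ∧ Set.range v = minimalMonomialGenerators I ∧
    ∀ i : Fin m, 0 < (i : ℕ) →
      ∃ A : Set σ,
        Submodule.colon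
            (Ideal.span ((fun j => MvPolynomial.monomial (v j) (1 : K)) '' {j | j < i}))
            {MvPolynomial.monomial (v i) (1 : K)} =
          Ideal.span (MvPolynomial.X '' A)

/-- An element `v` of the graded free module `⨁ₖ S(-shift k)`, `S = K[x_s : s ∈ σ]`, is
homogeneous of degree `t`. -/
def IsHomogeneousInFree {σ K : Type*} [Field K] {n : ℕ} (shift : Fin n → ℤ) (t : ℤ)
    (v : Fin n → MvPolynomial σ K) : Prop :=
  ∀ k, ∀ s ∈ (v k).support, (s.degree : ℤ) + shift k = t

/-- A minimal graded free resolution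
`0 → F_p → ⋯ → F_1 → F_0 → I → 0`, with `F_i = ⨁_{k < rank i} S(-shift i k)`, of an ideal `I` of
`S = K[x_s : s ∈ σ]`. The augmentation `F_0 → I` is given as a map to `S` with image `I`. -/
structure MinimalGradedFreeResolution {σ K : Type*} [Field K]
    (I : Ideal (MvPolynomial σ K)) where
  /-- the rank of `F_i` -/
  rank : ℕ → ℕ
  /-- the degrees of the basis elements of `F_i` -/
  shift : (i : ℕ) → Fin (rank i) → ℤ
  /-- the augmentation `F_0 → I ⊆ S` -/
  aug : (Fin (rank 0) → MvPolynomial σ K) →ₗ[MvPolynomial σ K] MvPolynomial σ K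
  /-- the differential `F_{i+1} → F_i` -/
  diff : (i : ℕ) → (Fin (rank (i + 1)) → MvPolynomial σ K) →ₗ[MvPolynomial σ K]
    (Fin (rank i) → MvPolynomial σ K)
  /-- the augmentation is homogeneous of degree zero -/
  aug_homogeneous : ∀ k, ∀ s ∈ (aug (Pi.single k 1)).support, (s.degree : ℤ) = shift 0 k
  /-- the differentials are homogeneous of degree zero -/
  diff_homogeneous : ∀ i k,
    IsHomogeneousInFree (shift i) (shift (i + 1) k) (diff i (Pi.single k 1))
  /-- exactness at `I` -/
  range_aug : LinearMap.range aug = I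
  /-- exactness at `F_0` -/
  exact_zero : LinearMap.range (diff 0) = LinearMap.ker aug
  /-- exactness at `F_{i+1}` -/
  exact_succ : ∀ i, LinearMap.range (diff (i + 1)) = LinearMap.ker (diff i)
  /-- minimality: the image of `F_{i+1}` lies in `𝔪 F_i`, where `𝔪` is generated by the
  variables -/
  minimal : ∀ i w k,
    diff i w k ∈ Ideal.span (Set.range (MvPolynomial.X : σ → MvPolynomial σ K))
  /-- the resolution has finite length -/
  finite_length : ∃ p, ∀ i, p < i → rank i = 0

/-- The graded Betti number `β_{i,j}`: the number of summands `S(-j)` of `F_i`. -/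
def MinimalGradedFreeResolution.betti {σ K : Type*} [Field K] {I : Ideal (MvPolynomial σ K)}
    (F : MinimalGradedFreeResolution I) (i : ℕ) (j : ℤ) : ℕ :=
  Fintype.card {k : Fin (F.rank i) // F.shift i k = j}

/-- The Castelnuovo–Mumford regularity `reg(I) = max {j - i | β_{i,j}(I) ≠ 0}` of a homogeneous
ideal of a polynomial ring in finitely many variables; it is `-∞` for `I = 0`. The minimal graded
free resolution is unique up to isomorphism, so every `F` contributes the same values `j - i`. -/
def regularity {σ K : Type*} [Field K] (I : Ideal (MvPolynomial σ K)) : EReal :=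
  ⨆ (F : MinimalGradedFreeResolution I) (i : ℕ) (j : ℤ) (_ : F.betti i j ≠ 0),
    (((j - i : ℤ) : ℝ) : EReal)

end

/-!
Write the generators as `uᵢ = x ^ aᵢ y ^ (d - aᵢ)` with `a₁ < ⋯ < aₘ`, and let `gᵢ = aᵢ₊₁ - aᵢ`.
The syzygies of the `uᵢ` are freely generated by the relations `x ^ gᵢ uᵢ = y ^ gᵢ uᵢ₊₁`, because
`x ^ gᵢ` generates the colon ideal `(uᵢ₊₁, …, uₘ) : uᵢ`
(`exists_eq_sum_staircaseRelation`, `staircaseRelation_injective`). This gives an explicit minimal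
resolution `staircaseResolution`, with degrees `d` in `F₀` and `d + gᵢ` in `F₁`, so that the
regularity is at least `d` and at least every `d + gᵢ - 1`.

The regularity is a supremum over all minimal graded free resolutions, so an upper bound has to
hold for each of them. Instead of proving that minimal resolutions are isomorphic, the degrees of an
arbitrary one are bounded by those of a fixed one. Graded comparison maps produce homogeneous
generators of low degree for the image and the kernel of the augmentation, and by minimality the
basis elements of `F₀` and `F₁` have no larger degree (`shift_le_of_range_le_span`,
`MinimalGradedFreeResolution.shift_zero_le`, `MinimalGradedFreeResolution.shift_one_le`). If the
fixed resolution has length one, then so has every other, by Nakayama's lemma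
(`MinimalGradedFreeResolution.rank_add_two_eq_zero`). Hence `reg I = d` exactly when all `gᵢ` are
one.

If all `gᵢ` are one, the colon ideals of the given order of the generators are all `(y)`.
Conversely, a colon ideal generated by variables forces the new generator to have its exponent of
`x` within one of that of an earlier generator, so that an ordering with linear quotients can never
cross a gap `gᵢ ≥ 2`.
-/

open MvPolynomial

/-! ### Homogeneous components in graded free modules -/

/-- The component of degree `t` of an element of `⨁ₖ S(-shift k)`. -/
noncomputable def freeComponent {σ K : Type*} [Field K] {n : ℕ} (shift : Fin n → ℤ) (t : ℤ)
    (v : Fin n → MvPolynomial σ K) : Fin n → MvPolynomial σ K :=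
  fun k => weightedHomogeneousComponent (fun _ : σ => (1 : ℤ)) (t - shift k) (v k)

section Graded

variable {σ K : Type*} [Field K]

theorem coeff_weightedHomogeneousComponent_one (t : ℤ) (p : MvPolynomial σ K) (s : σ →₀ ℕ) :
    coeff s (weightedHomogeneousComponent (fun _ : σ => (1 : ℤ)) t p) =
      if (s.degree : ℤ) = t then coeff s p else 0 := by
  have hs : Finsupp.weight (fun _ : σ => (1 : ℤ)) s = (s.degree : ℤ) := by
    simp [Finsupp.weight_apply, Finsupp.degree_apply, Finsupp.sum]
  classical
  rw [coeff_weightedHomogeneousComponent, hs]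

theorem weightedHomogeneousComponent_one_mul (t e : ℤ) (p q : MvPolynomial σ K)
    (hq : ∀ s ∈ q.support, (s.degree : ℤ) = e) :
    weightedHomogeneousComponent (fun _ : σ => (1 : ℤ)) t (p * q) =
      weightedHomogeneousComponent (fun _ : σ => (1 : ℤ)) (t - e) p * q := by
  classical
  ext s
  have hs : (if (s.degree : ℤ) = t then coeff s (p * q) else 0) =
      ∑ x ∈ Finset.HasAntidiagonal.antidiagonal s,
        if (s.degree : ℤ) = t then coeff x.1 p * coeff x.2 q else 0 := by
    split_ifs
    · rw [coeff_mul]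
    · simp
  rw [coeff_weightedHomogeneousComponent_one, hs, coeff_mul]
  refine Finset.sum_congr rfl fun x hx => ?_
  rw [coeff_weightedHomogeneousComponent_one, ite_mul, zero_mul]
  by_cases hq0 : coeff x.2 q = 0
  · simp [hq0]
  · have h1 := hq x.2 (mem_support_iff.2 hq0)
    have h2 : (s.degree : ℤ) = x.1.degree + x.2.degree := by
      rw [← Finset.HasAntidiagonal.mem_antidiagonal.1 hx, map_add]
      push_cast
      rfl
    congr 1
    exact propext (by omega)

theorem isHomogeneousInFree_iff {n : ℕ} {shift : Fin n → ℤ} {t : ℤ}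
    {v : Fin n → MvPolynomial σ K} :
    IsHomogeneousInFree shift t v ↔ freeComponent shift t v = v := by
  constructor
  · intro h
    funext k
    ext s
    rw [freeComponent, coeff_weightedHomogeneousComponent_one]
    split_ifs with hs
    · rfl
    · by_contra hne
      have := h k s (mem_support_iff.2 (Ne.symm hne))
      omega
  · intro h k s hs
    rw [← h, mem_support_iff, freeComponent, coeff_weightedHomogeneousComponent_one] at hs
    by_contra hne
    exact hs (if_neg (by omega))

theorem isHomogeneousInFree_freeComponent {n : ℕ} (shift : Fin n → ℤ) (t : ℤ)
    (v : Fin n → MvPolynomial σ K) :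
    IsHomogeneousInFree shift t (freeComponent shift t v) := by
  intro k s hs
  rw [mem_support_iff, freeComponent, coeff_weightedHomogeneousComponent_one] at hs
  by_contra hne
  exact hs (if_neg (by omega))

theorem IsHomogeneousInFree.sub {n : ℕ} {shift : Fin n → ℤ} {t : ℤ}
    {v w : Fin n → MvPolynomial σ K} (hv : IsHomogeneousInFree shift t v)
    (hw : IsHomogeneousInFree shift t w) : IsHomogeneousInFree shift t (v - w) := by
  rw [isHomogeneousInFree_iff] at *
  nth_rw 2 [← hv, ← hw]
  funext k
  simp [freeComponent]

theorem isHomogeneousInFree_single {n : ℕ} (shift : Fin n → ℤ) (k : Fin n) :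
    IsHomogeneousInFree shift (shift k) (Pi.single k (1 : MvPolynomial σ K)) := by
  classical
  intro j s hs
  rcases eq_or_ne j k with rfl | hjk
  · rw [Pi.single_eq_same, mem_support_iff, coeff_one] at hs
    have : s = 0 := by
      by_contra h
      exact hs (if_neg (Ne.symm h))
    simp [this]
  · simp [Pi.single_eq_of_ne hjk] at hs

theorem IsHomogeneousInFree.eq_zero_of_lt {n : ℕ} {shift : Fin n → ℤ} {t : ℤ}
    {v : Fin n → MvPolynomial σ K} (hv : IsHomogeneousInFree shift t v) {k : Fin n}
    (hk : t < shift k) : v k = 0 := by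
  rw [← support_eq_empty, Finset.eq_empty_iff_forall_notMem]
  intro s hs
  have := hv k s hs
  omega

/-- A map of graded free modules that sends basis vectors to homogeneous vectors of the same
degree commutes with taking homogeneous components. -/
theorem map_freeComponent {n n' : ℕ} {a : Fin n → ℤ} {b : Fin n' → ℤ}
    (D : (Fin n → MvPolynomial σ K) →ₗ[MvPolynomial σ K] (Fin n' → MvPolynomial σ K))
    (hD : ∀ k, IsHomogeneousInFree b (a k) (D (Pi.single k 1))) (t : ℤ)
    (v : Fin n → MvPolynomial σ K) :
    D (freeComponent a t v) = freeComponent b t (D v) := by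
  funext j
  have key (w : Fin n → MvPolynomial σ K) :
      D w j = ∑ k, w k * D (Pi.single k 1) j := by
    rw [LinearMap.pi_apply_eq_sum_univ D w, Finset.sum_apply]
    refine Finset.sum_congr rfl fun k _ => ?_
    rw [Pi.smul_apply, smul_eq_mul]
    have hk : (fun i => if k = i then (1 : MvPolynomial σ K) else 0) = Pi.single k 1 := by
      funext i
      simp [Pi.single_apply, eq_comm]
    rw [hk]
  rw [key, freeComponent, key, map_sum]
  refine Finset.sum_congr rfl fun k _ => ?_
  rw [weightedHomogeneousComponent_one_mul _ (a k - b j)]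
  · rw [freeComponent, sub_sub_sub_cancel_right]
  · intro s hs
    have := hD k j s hs
    omega

theorem IsHomogeneousInFree.map {n n' : ℕ} {a : Fin n → ℤ} {b : Fin n' → ℤ}
    {D : (Fin n → MvPolynomial σ K) →ₗ[MvPolynomial σ K] (Fin n' → MvPolynomial σ K)}
    (hD : ∀ k, IsHomogeneousInFree b (a k) (D (Pi.single k 1))) {t : ℤ}
    {v : Fin n → MvPolynomial σ K} (hv : IsHomogeneousInFree a t v) :
    IsHomogeneousInFree b t (D v) := by
  rw [isHomogeneousInFree_iff] at hv ⊢
  rw [← map_freeComponent D hD, hv]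

/-- A homogeneous element in the image of a graded map has a homogeneous preimage of the same
degree. -/
theorem IsHomogeneousInFree.exists_preimage {n n' : ℕ} {a : Fin n → ℤ} {b : Fin n' → ℤ}
    {D : (Fin n → MvPolynomial σ K) →ₗ[MvPolynomial σ K] (Fin n' → MvPolynomial σ K)}
    (hD : ∀ k, IsHomogeneousInFree b (a k) (D (Pi.single k 1))) {t : ℤ}
    {x : Fin n' → MvPolynomial σ K} (hx : IsHomogeneousInFree b t x)
    (hmem : x ∈ LinearMap.range D) :
    ∃ w, IsHomogeneousInFree a t w ∧ D w = x := by
  obtain ⟨v, rfl⟩ := hmem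
  exact ⟨freeComponent a t v, isHomogeneousInFree_freeComponent a t v,
    by rw [map_freeComponent D hD, isHomogeneousInFree_iff.1 hx]⟩

theorem one_notMem_span_range_X :
    (1 : MvPolynomial σ K) ∉ Ideal.span (Set.range (X : σ → MvPolynomial σ K)) := by
  intro h
  have hle : Ideal.span (Set.range (X : σ → MvPolynomial σ K)) ≤
      RingHom.ker (constantCoeff : MvPolynomial σ K →+* K) := by
    rw [Ideal.span_le]
    rintro _ ⟨i, rfl⟩
    simp [RingHom.mem_ker]
  simpa [RingHom.mem_ker] using hle h

/-- The graded Nakayama argument: if a graded map out of a free module is minimal and its image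
is generated by homogeneous elements of degree at most `B`, then so is the free module. -/
theorem shift_le_of_range_le_span {n n' : ℕ} {a : Fin n → ℤ} {b : Fin n' → ℤ}
    {D : (Fin n → MvPolynomial σ K) →ₗ[MvPolynomial σ K] (Fin n' → MvPolynomial σ K)}
    (hD : ∀ k, IsHomogeneousInFree b (a k) (D (Pi.single k 1)))
    (hmin : ∀ v ∈ LinearMap.ker D, ∀ k, v k ∈ Ideal.span (Set.range (X : σ → MvPolynomial σ K)))
    {B : ℤ} {T : Set (Fin n' → MvPolynomial σ K)}
    (hT : ∀ x ∈ T, x ∈ LinearMap.range D ∧ ∃ t ≤ B, IsHomogeneousInFree b t x)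
    (hspan : LinearMap.range D ≤ Submodule.span (MvPolynomial σ K) T) (k : Fin n) :
    a k ≤ B := by
  by_contra! hk
  -- Preimages of degree at most `B < a k` have vanishing `k`-th coordinate.
  have hle : LinearMap.range D ≤
      (LinearMap.ker (LinearMap.proj (R := MvPolynomial σ K)
        (φ := fun _ : Fin n => MvPolynomial σ K) k)).map D := by
    refine hspan.trans (Submodule.span_le.2 fun x hx => ?_)
    obtain ⟨hxr, t, ht, hxt⟩ := hT x hx
    obtain ⟨w, hw, rfl⟩ := hxt.exists_preimage hD hxr
    exact ⟨w, hw.eq_zero_of_lt (ht.trans_lt hk), rfl⟩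
  obtain ⟨w, hw, hwD⟩ := hle ⟨Pi.single k 1, rfl⟩
  have hw0 : w k = 0 := hw
  have := hmin (Pi.single k 1 - w) (by simp [hwD]) k
  rw [Pi.sub_apply, hw0, Pi.single_eq_same, sub_zero] at this
  exact one_notMem_span_range_X this

/-- Lifting a map out of a free module, with control on the images of the basis vectors. -/
theorem exists_lift_of_basis {S M N : Type*} [CommRing S] [AddCommGroup M] [Module S M]
    [AddCommGroup N] [Module S N] {n : ℕ} (f : (Fin n → S) →ₗ[S] M) (g : N →ₗ[S] M)
    {P : Fin n → N → Prop} (h : ∀ k, ∃ w, P k w ∧ g w = f (Pi.single k 1)) :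
    ∃ φ : (Fin n → S) →ₗ[S] N, (∀ v, g (φ v) = f v) ∧ ∀ k, P k (φ (Pi.single k 1)) := by
  choose w hP hw using h
  refine ⟨Fintype.linearCombination S w, fun v => ?_, fun k => ?_⟩
  · have : g ∘ₗ Fintype.linearCombination S w = f := by
      refine LinearMap.pi_ext' fun k => LinearMap.ext_ring ?_
      simp [hw]
    exact LinearMap.congr_fun this v
  · simpa using hP k

theorem exists_lift {S M N : Type*} [CommRing S] [AddCommGroup M] [Module S M]
    [AddCommGroup N] [Module S N] {n : ℕ} (f : (Fin n → S) →ₗ[S] M) (g : N →ₗ[S] M)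
    (h : LinearMap.range f ≤ LinearMap.range g) :
    ∃ φ : (Fin n → S) →ₗ[S] N, ∀ v, g (φ v) = f v := by
  obtain ⟨φ, hφ, -⟩ := exists_lift_of_basis f g (P := fun _ _ => True) fun k => by
    obtain ⟨w, hw⟩ := h ⟨Pi.single k 1, rfl⟩
    exact ⟨w, trivial, hw⟩
  exact ⟨φ, hφ⟩

theorem mem_smul_top_of_forall_mem {S : Type*} [CommRing S] {n : ℕ} {J : Ideal S}
    {v : Fin n → S} (h : ∀ k, v k ∈ J) : v ∈ J • (⊤ : Submodule S (Fin n → S)) := by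
  have hv : v = ∑ k, v k • (Pi.single k 1 : Fin n → S) := by
    funext i
    simp [Finset.sum_apply, Pi.single_apply]
  rw [hv]
  exact Submodule.sum_mem _ fun k _ => Submodule.smul_mem_smul (h k) Submodule.mem_top

end Graded

/-! ### Comparison of minimal graded free resolutions -/

section Comparison

variable {σ K : Type*} [Field K] {I : Ideal (MvPolynomial σ K)}

theorem range_le_span_range_single {S M : Type*} [CommRing S] [AddCommGroup M] [Module S M]
    {n : ℕ} (f : (Fin n → S) →ₗ[S] M) :
    LinearMap.range f ≤ Submodule.span S (Set.range fun k => f (Pi.single k 1)) := by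
  rintro _ ⟨v, rfl⟩
  have hv : v = ∑ k, v k • (Pi.single k 1 : Fin n → S) := by
    funext i
    simp [Finset.sum_apply, Pi.single_apply]
  rw [hv, map_sum]
  refine Submodule.sum_mem _ fun k _ => ?_
  rw [map_smul]
  exact Submodule.smul_mem _ _ (Submodule.subset_span ⟨k, rfl⟩)

namespace MinimalGradedFreeResolution

/-- The augmentation, with target the free module `S¹` instead of `S`, so that it is a map of
graded free modules like the differentials. -/
noncomputable def augVec (F : MinimalGradedFreeResolution I) :
    (Fin (F.rank 0) → MvPolynomial σ K) →ₗ[MvPolynomial σ K] (Fin 1 → MvPolynomial σ K) :=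
  LinearMap.pi fun _ => F.aug

theorem augVec_homogeneous (F : MinimalGradedFreeResolution I) (k : Fin (F.rank 0)) :
    IsHomogeneousInFree (fun _ => 0) (F.shift 0 k) (F.augVec (Pi.single k 1)) := by
  intro _ s hs
  rw [add_zero]
  exact F.aug_homogeneous k s hs

theorem mem_range_augVec (F : MinimalGradedFreeResolution I) (x : Fin 1 → MvPolynomial σ K) :
    x ∈ LinearMap.range F.augVec ↔ x 0 ∈ I := by
  have hI (p) : p ∈ I ↔ p ∈ LinearMap.range F.aug := by rw [F.range_aug]
  rw [hI]
  constructor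
  · rintro ⟨v, rfl⟩
    exact ⟨v, rfl⟩
  · rintro ⟨v, hv⟩
    refine ⟨v, funext fun i => ?_⟩
    rw [Subsingleton.elim i 0]
    exact hv

theorem range_augVec_eq (F G : MinimalGradedFreeResolution I) :
    LinearMap.range F.augVec = LinearMap.range G.augVec := by
  ext x
  rw [F.mem_range_augVec, G.mem_range_augVec]

theorem augVec_eq_zero_iff (F : MinimalGradedFreeResolution I)
    (v : Fin (F.rank 0) → MvPolynomial σ K) : F.augVec v = 0 ↔ v ∈ LinearMap.range (F.diff 0) := by
  rw [F.exact_zero, LinearMap.mem_ker]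
  constructor
  · intro h
    exact congrFun h 0
  · intro h
    funext i
    exact h

theorem diff_eq_zero_iff (F : MinimalGradedFreeResolution I) (i : ℕ)
    (v : Fin (F.rank (i + 1)) → MvPolynomial σ K) :
    F.diff i v = 0 ↔ v ∈ LinearMap.range (F.diff (i + 1)) := by
  rw [F.exact_succ, LinearMap.mem_ker]

theorem apply_mem_of_mem_ker_diff (F : MinimalGradedFreeResolution I) (i : ℕ)
    (v : Fin (F.rank (i + 1)) → MvPolynomial σ K) (hv : v ∈ LinearMap.ker (F.diff i))
    (k : Fin (F.rank (i + 1))) : v k ∈ Ideal.span (Set.range (X : σ → MvPolynomial σ K)) := by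
  obtain ⟨w, rfl⟩ := (F.diff_eq_zero_iff i v).1 hv
  exact F.minimal _ _ _

theorem apply_mem_of_mem_ker_augVec (F : MinimalGradedFreeResolution I)
    (v : Fin (F.rank 0) → MvPolynomial σ K) (hv : v ∈ LinearMap.ker F.augVec)
    (k : Fin (F.rank 0)) : v k ∈ Ideal.span (Set.range (X : σ → MvPolynomial σ K)) := by
  obtain ⟨w, rfl⟩ := (F.augVec_eq_zero_iff v).1 hv
  exact F.minimal _ _ _

theorem shift_zero_le (F G : MinimalGradedFreeResolution I) {a : ℤ}
    (ha : ∀ k, G.shift 0 k ≤ a) (k : Fin (F.rank 0)) : F.shift 0 k ≤ a := by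
  refine shift_le_of_range_le_span F.augVec_homogeneous F.apply_mem_of_mem_ker_augVec
    (T := Set.range fun k => G.augVec (Pi.single k 1)) ?_ ?_ k
  · rintro _ ⟨k, rfl⟩
    rw [F.range_augVec_eq G]
    exact ⟨⟨_, rfl⟩, _, ha k, G.augVec_homogeneous k⟩
  · rw [F.range_augVec_eq G]
    exact range_le_span_range_single _

/-- Two resolutions of the same ideal are compared by a graded map in homological degree zero. -/
theorem exists_graded_comparison (F G : MinimalGradedFreeResolution I) :
    ∃ φ : (Fin (F.rank 0) → MvPolynomial σ K) →ₗ[MvPolynomial σ K]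
        (Fin (G.rank 0) → MvPolynomial σ K),
      (∀ v, G.augVec (φ v) = F.augVec v) ∧
        ∀ k, IsHomogeneousInFree (G.shift 0) (F.shift 0 k) (φ (Pi.single k 1)) := by
  refine exists_lift_of_basis F.augVec G.augVec
    (P := fun k w => IsHomogeneousInFree (G.shift 0) (F.shift 0 k) w) fun k => ?_
  refine (F.augVec_homogeneous k).exists_preimage G.augVec_homogeneous ?_
  rw [G.range_augVec_eq F]
  exact ⟨_, rfl⟩

/-- With `φ : F₀ → G₀` and `ψ : G₀ → F₀` comparison maps, `x = ψ (φ x) + (x - ψ (φ x))` shows that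
the syzygies of `F` are generated by the images under `ψ` of the syzygies of `G` and by the
elements `e - ψ (φ e)` for `e` in the basis of `F₀`. -/
theorem shift_one_le (F G : MinimalGradedFreeResolution I) {a b : ℤ}
    (ha : ∀ k, G.shift 0 k ≤ a) (hb : ∀ k, G.shift 1 k ≤ b) (hab : a ≤ b)
    (k : Fin (F.rank 1)) : F.shift 1 k ≤ b := by
  obtain ⟨φ, hφ, hφh⟩ := exists_graded_comparison F G
  obtain ⟨ψ, hψ, hψh⟩ := exists_graded_comparison G F
  have hrange (x) (hx : F.augVec x = 0) :
      φ x ∈ LinearMap.range (G.diff 0) := by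
    rw [← G.augVec_eq_zero_iff, hφ, hx]
  refine shift_le_of_range_le_span (F.diff_homogeneous 0) (F.apply_mem_of_mem_ker_diff 0)
    (T := (Set.range fun k => (ψ ∘ₗ G.diff 0) (Pi.single k 1)) ∪
      Set.range fun k =>
        (LinearMap.id - ψ ∘ₗ φ : Module.End (MvPolynomial σ K) _) (Pi.single k 1)) ?_ ?_ k
  · rintro _ (⟨k, rfl⟩ | ⟨k, rfl⟩)
    · refine ⟨?_, G.shift 1 k, hb k, (G.diff_homogeneous 0 k).map hψh⟩
      rw [← F.augVec_eq_zero_iff]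
      dsimp only [LinearMap.comp_apply]
      rw [hψ, G.augVec_eq_zero_iff]
      exact ⟨_, rfl⟩
    · refine ⟨?_, F.shift 0 k, (F.shift_zero_le G ha k).trans hab, ?_⟩
      · rw [← F.augVec_eq_zero_iff]
        simp [hψ, hφ]
      · exact (isHomogeneousInFree_single _ _).sub ((hφh k).map hψh)
  · intro x hx
    obtain ⟨y, hy⟩ := hrange x ((F.augVec_eq_zero_iff x).2 hx)
    have hxy : x = (ψ ∘ₗ G.diff 0) y + 
        (LinearMap.id - ψ ∘ₗ φ : Module.End (MvPolynomial σ K) _) x := by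
      simp [hy]
    rw [hxy, Submodule.span_union]
    exact Submodule.add_mem_sup (range_le_span_range_single _ ⟨y, rfl⟩)
      (range_le_span_range_single _ ⟨x, rfl⟩)

/-- If some resolution has length one, then the first syzygies are projective, so that the second
syzygies `Z ⊆ 𝔪 F₁` of any minimal resolution are a direct summand of `F₁`. Hence `Z = 𝔪 Z`, and
`Z = 0` by Nakayama's lemma. -/
theorem diff_one_eq_zero (F G : MinimalGradedFreeResolution I) (hG : G.rank 2 = 0) :
    LinearMap.range (F.diff 1) = ⊥ := by
  obtain ⟨φ, hφ, -⟩ := exists_graded_comparison F G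
  obtain ⟨ψ, hψ, -⟩ := exists_graded_comparison G F
  have hinj (y) (hy : G.diff 0 y = 0) : y = 0 := by
    obtain ⟨w, rfl⟩ := (G.diff_eq_zero_iff 0 y).1 hy
    have : IsEmpty (Fin (G.rank (0 + 1 + 1))) := by
      rw [show G.rank (0 + 1 + 1) = 0 from hG]
      infer_instance
    rw [Subsingleton.elim w 0, map_zero]
  obtain ⟨φ₁, hφ₁⟩ := exists_lift (φ ∘ₗ F.diff 0) (G.diff 0) (by
    rintro _ ⟨v, rfl⟩
    rw [← G.augVec_eq_zero_iff, LinearMap.comp_apply, hφ, F.augVec_eq_zero_iff]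
    exact ⟨v, rfl⟩)
  obtain ⟨ψ₁, hψ₁⟩ := exists_lift (ψ ∘ₗ G.diff 0) (F.diff 0) (by
    rintro _ ⟨v, rfl⟩
    rw [← F.augVec_eq_zero_iff, LinearMap.comp_apply, hψ, G.augVec_eq_zero_iff]
    exact ⟨v, rfl⟩)
  obtain ⟨h, hh⟩ := exists_lift (LinearMap.id - ψ ∘ₗ φ) (F.diff 0) (by
    rintro _ ⟨v, rfl⟩
    rw [← F.augVec_eq_zero_iff]
    simp [hψ, hφ])
  -- `P` is a projection of `F₁` onto the kernel of `F₁ → F₀`.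
  set P := LinearMap.id - (ψ₁ ∘ₗ φ₁ + h ∘ₗ F.diff 0) with hP
  have hPker (x) : P x ∈ LinearMap.range (F.diff 1) := by
    rw [← F.diff_eq_zero_iff]
    have h1 : F.diff 0 (ψ₁ (φ₁ x)) = ψ (φ (F.diff 0 x)) := by
      rw [hψ₁, LinearMap.comp_apply, hφ₁, LinearMap.comp_apply]
    simp [hP, h1, hh]
  have hPid (z) (hz : z ∈ LinearMap.range (F.diff 1)) : P z = z := by
    have h0 : F.diff 0 z = 0 := (F.diff_eq_zero_iff 0 z).2 hz
    have h1 : φ₁ z = 0 := hinj _ (by rw [hφ₁, LinearMap.comp_apply, h0, map_zero])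
    simp [hP, h0, h1]
  set J := Ideal.span (Set.range (X : σ → MvPolynomial σ K)) with hJ
  have hle : LinearMap.range (F.diff 1) ≤ J • LinearMap.range (F.diff 1) := by
    intro z hz
    have hz' : z ∈ J • (⊤ : Submodule _ (Fin (F.rank 1) → MvPolynomial σ K)) :=
      mem_smul_top_of_forall_mem
        (F.apply_mem_of_mem_ker_diff 0 z ((F.diff_eq_zero_iff 0 z).2 hz))
    have hPz := Submodule.mem_map_of_mem (f := P) hz'
    rw [hPid z hz, Submodule.map_smul''] at hPz
    refine Submodule.smul_mono le_rfl ?_ hPz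
    rintro _ ⟨x, -, rfl⟩
    exact hPker x
  obtain ⟨r, hr, hrz⟩ := Submodule.exists_sub_one_mem_and_smul_eq_zero_of_fg_of_le_smul J
    (LinearMap.range (F.diff 1)) (Submodule.fg_range _) hle
  have hr0 : r ≠ 0 := by
    rintro rfl
    rw [zero_sub, neg_mem_iff] at hr
    exact one_notMem_span_range_X hr
  rw [eq_bot_iff]
  intro z hz
  exact (smul_eq_zero.1 (hrz z hz)).resolve_left hr0

theorem rank_add_two_eq_zero (F G : MinimalGradedFreeResolution I) (hG : G.rank 2 = 0) (i : ℕ) :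
    F.rank (i + 2) = 0 := by
  have key (j : ℕ) (h : LinearMap.range (F.diff j) = ⊥) : F.rank (j + 1) = 0 := by
    by_contra hne
    have := F.apply_mem_of_mem_ker_diff j (Pi.single ⟨0, Nat.pos_of_ne_zero hne⟩ 1)
      (by
        rw [LinearMap.range_eq_bot.1 h]
        simp) ⟨0, Nat.pos_of_ne_zero hne⟩
    rw [Pi.single_eq_same] at this
    exact one_notMem_span_range_X this
  induction i with
  | zero => exact key 1 (F.diff_one_eq_zero G hG)
  | succ i ih =>
    refine key (i + 2) ?_
    have : IsEmpty (Fin (F.rank (i + 2))) := by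
      rw [ih]
      infer_instance
    rw [LinearMap.range_eq_bot]
    exact Subsingleton.elim _ _

end MinimalGradedFreeResolution

end Comparison

/-! ### Relations between consecutive generators -/

section Staircase

/-- The relation `xᵢ eᵢ - yᵢ eᵢ₊₁` between two consecutive generators. -/
def staircaseRelation {S : Type*} [CommRing S] {n : ℕ} (x y : Fin n → S) (i : Fin n) :
    Fin (n + 1) → S :=
  Pi.single i.castSucc (x i) - Pi.single i.succ (y i)

theorem staircaseRelation_succ {S : Type*} [CommRing S] {n : ℕ} (x y : Fin (n + 1) → S)
    (i : Fin n) : staircaseRelation x y i.succ =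
      Fin.cons 0 (staircaseRelation (fun j => x j.succ) (fun j => y j.succ) i) := by
  funext j
  refine Fin.cases ?_ (fun j => ?_) j
  · simp [staircaseRelation, Fin.ext_iff]
  · simp [staircaseRelation, Pi.single_apply, Fin.ext_iff]

theorem sum_smul_staircaseRelation_zero {S : Type*} [CommRing S] {n : ℕ}
    (x y : Fin (n + 1) → S) (q : Fin (n + 1) → S) :
    (∑ i, q i • staircaseRelation x y i) 0 = q 0 * x 0 := by
  rw [Fin.sum_univ_succ]
  simp only [staircaseRelation_succ]
  simp [staircaseRelation, Finset.sum_apply]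

theorem sum_smul_staircaseRelation_succ {S : Type*} [CommRing S] {n : ℕ}
    (x y : Fin (n + 1) → S) (q : Fin (n + 1) → S) (j : Fin (n + 1)) :
    (∑ i, q i • staircaseRelation x y i) j.succ = q 0 * staircaseRelation x y 0 j.succ +
      (∑ i : Fin n, q i.succ •
        staircaseRelation (fun j => x j.succ) (fun j => y j.succ) i) j := by
  rw [Fin.sum_univ_succ]
  simp only [staircaseRelation_succ]
  simp [Finset.sum_apply]

theorem staircaseRelation_injective {S : Type*} [CommRing S] [IsDomain S] {n : ℕ}
    (x y : Fin n → S) (hx : ∀ i, x i ≠ 0) (q : Fin n → S)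
    (h : ∑ i, q i • staircaseRelation x y i = 0) : q = 0 := by
  induction n with
  | zero => exact Subsingleton.elim _ _
  | succ n ih =>
    have h0 : q 0 = 0 := by
      have := congrFun h 0
      rw [sum_smul_staircaseRelation_zero] at this
      exact (mul_eq_zero.1 this).resolve_right (hx 0)
    have ht := ih (fun j => x j.succ) (fun j => y j.succ) (fun j => hx j.succ)
      (fun j => q j.succ) (by
        funext j
        have := congrFun h j.succ
        rwa [sum_smul_staircaseRelation_succ, h0, zero_mul, zero_add] at this)
    funext j
    exact Fin.cases h0 (fun j => congrFun ht j) j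

/-- If `xᵢ` generates the colon ideal `(pᵢ₊₁, pᵢ₊₂, …) : pᵢ` for all `i`, then the relations
`xᵢ pᵢ = yᵢ pᵢ₊₁` generate all relations between the `pᵢ`. -/
theorem exists_eq_sum_staircaseRelation {S : Type*} [CommRing S] [IsDomain S] {n : ℕ}
    (p : Fin (n + 1) → S) (x y : Fin n → S)
    (hrel : ∀ i, x i * p i.castSucc = y i * p i.succ)
    (hdvd : ∀ i f, f * p i.castSucc ∈ Ideal.span (p '' Set.Ioi i.castSucc) → x i ∣ f)
    (hp : p (Fin.last n) ≠ 0) (f : Fin (n + 1) → S) (hf : ∑ i, f i * p i = 0) :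
    ∃ q : Fin n → S, ∑ i, q i • staircaseRelation x y i = f := by
  induction n with
  | zero =>
    refine ⟨0, ?_⟩
    funext i
    rw [Fin.sum_univ_one] at hf
    have h0 : f 0 = 0 := (mul_eq_zero.1 hf).resolve_right hp
    rw [Fin.fin_one_eq_zero i, h0]
    simp
  | succ n ih =>
    rw [Fin.sum_univ_succ] at hf
    obtain ⟨c, hc⟩ := hdvd 0 (f 0) (by
      rw [Fin.castSucc_zero, eq_neg_of_add_eq_zero_left hf]
      refine neg_mem (Submodule.sum_mem _ fun j _ => Ideal.mul_mem_left _ _ ?_)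
      exact Ideal.subset_span ⟨j.succ, Fin.succ_pos j, rfl⟩)
    obtain ⟨q, hq⟩ := ih (fun j => p j.succ) (fun j => x j.succ) (fun j => y j.succ)
      (fun j => hrel j.succ) (fun i g hg => hdvd i.succ g (by
        refine Ideal.span_mono ?_ hg
        rintro _ ⟨j, hj, rfl⟩
        exact ⟨j.succ, Fin.succ_lt_succ_iff.2 hj, rfl⟩)) hp
      (fun j => f j.succ - c * staircaseRelation x y 0 j.succ) (by
        have h1 : ∑ j : Fin (n + 1), c * staircaseRelation x y 0 j.succ * p j.succ =
            -(c * (y 0 * p 1)) := by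
          rw [Fin.sum_univ_succ]
          simp [staircaseRelation, Fin.ext_iff]
          ring
        simp only [sub_mul]
        rw [Finset.sum_sub_distrib, h1]
        have h2 : x 0 * p 0 = y 0 * p 1 := hrel 0
        rw [hc] at hf
        linear_combination hf - c * h2)
    refine ⟨Fin.cons c q, funext fun j => ?_⟩
    refine Fin.cases ?_ (fun j => ?_) j
    · rw [sum_smul_staircaseRelation_zero, hc, Fin.cons_zero, mul_comm]
    · rw [sum_smul_staircaseRelation_succ]
      simp only [Fin.cons_succ, Fin.cons_zero, hq]
      ring

end Staircase

/-! ### The Hilbert–Burch resolution and the regularity -/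

section Resolution

variable {K : Type*} [Field K]

theorem degree_eq_add_of_fin_two (s : Fin 2 →₀ ℕ) : s.degree = s 0 + s 1 := by
  rw [Finsupp.degree_eq_sum, Fin.sum_univ_two]

/-- The gap between the exponents of the first variable in consecutive generators. -/
def staircaseGap {n : ℕ} (u : Fin (n + 1) → (Fin 2 →₀ ℕ)) (i : Fin n) : ℕ :=
  u i.succ 0 - u i.castSucc 0

theorem staircaseGap_pos {n : ℕ} {u : Fin (n + 1) → (Fin 2 →₀ ℕ)}
    (hmono : StrictMono fun i => u i 0) (i : Fin n) : 0 < staircaseGap u i :=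
  Nat.sub_pos_of_lt (hmono i.castSucc_lt_succ)

theorem staircaseGap_add {n : ℕ} {u : Fin (n + 1) → (Fin 2 →₀ ℕ)}
    (hmono : StrictMono fun i => u i 0) (i : Fin n) :
    staircaseGap u i + u i.castSucc 0 = u i.succ 0 :=
  Nat.sub_add_cancel (hmono i.castSucc_lt_succ).le

/-- If all exponents in `U` exceed that of `u₀` by at least `g` in the variable `i`, then the colon
ideal of the monomial ideal generated by `U` by the monomial `u₀` lies in `(Xᵢ ^ g)`. -/
theorem X_pow_dvd_of_mul_mem {u₀ : Fin 2 →₀ ℕ} {U : Set (Fin 2 →₀ ℕ)} {i : Fin 2} {g : ℕ}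
    (hU : ∀ a ∈ U, g + u₀ i ≤ a i) {f : MvPolynomial (Fin 2) K}
    (hf : f * monomial u₀ 1 ∈ Ideal.span ((fun a => monomial a (1 : K)) '' U)) :
    (X i : MvPolynomial (Fin 2) K) ^ g ∣ f := by
  rw [X_pow_eq_monomial, ← Ideal.mem_span_singleton,
    ← Set.image_singleton (f := fun a => monomial a (1 : K)), mem_ideal_span_monomial_image]
  intro s hs
  refine ⟨Finsupp.single i g, rfl, ?_⟩
  rw [mem_ideal_span_monomial_image] at hf
  obtain ⟨a, ha, hle⟩ := hf (s + u₀) (by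
    rw [mem_support_iff, coeff_mul_monomial, mul_one]
    exact mem_support_iff.1 hs)
  have h1 := hU a ha
  have h2 := hle i
  rw [Finsupp.add_apply] at h2
  rw [Finsupp.single_le_iff]
  omega

theorem staircase_relation {n d : ℕ} {u : Fin (n + 1) → (Fin 2 →₀ ℕ)}
    (hmono : StrictMono fun i => u i 0) (hdeg : ∀ i, u i 0 + u i 1 = d) (i : Fin n) :
    (X 0 : MvPolynomial (Fin 2) K) ^ staircaseGap u i * monomial (u i.castSucc) 1 =
      X 1 ^ staircaseGap u i * monomial (u i.succ) 1 := by
  rw [X_pow_eq_monomial, X_pow_eq_monomial, monomial_mul, monomial_mul]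
  congr 2
  have h := staircaseGap_add hmono i
  have h1 := hdeg i.castSucc
  have h2 := hdeg i.succ
  ext j
  fin_cases j
  · simp [h]
  · simp
    omega

/-- The relations between consecutive generators generate all syzygies. -/
theorem range_staircaseRelation_eq_ker {n d : ℕ} {u : Fin (n + 1) → (Fin 2 →₀ ℕ)}
    (hmono : StrictMono fun i => u i 0) (hdeg : ∀ i, u i 0 + u i 1 = d) :
    LinearMap.range (Fintype.linearCombination (MvPolynomial (Fin 2) K) (staircaseRelation
        (fun i => X 0 ^ staircaseGap u i) fun i => X 1 ^ staircaseGap u i)) =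
      LinearMap.ker (Fintype.linearCombination (MvPolynomial (Fin 2) K)
        fun i => monomial (u i) (1 : K)) := by
  ext f
  rw [LinearMap.mem_ker]
  constructor
  · rintro ⟨q, rfl⟩
    rw [Fintype.linearCombination_apply _ (staircaseRelation _ _), map_sum]
    refine Finset.sum_eq_zero fun i _ => ?_
    rw [map_smul, staircaseRelation, map_sub, Fintype.linearCombination_apply_single,
      Fintype.linearCombination_apply_single, smul_eq_mul, smul_eq_mul,
      smul_eq_mul, staircase_relation hmono hdeg, sub_self, mul_zero]
  · intro hf
    obtain ⟨q, hq⟩ := exists_eq_sum_staircaseRelation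
      (fun i => monomial (u i) (1 : K)) _ _ (staircase_relation hmono hdeg) (by
        intro i g hg
        refine X_pow_dvd_of_mul_mem (U := u '' Set.Ioi i.castSucc) ?_ ?_
          (u₀ := u i.castSucc)
        · rintro _ ⟨j, hj, rfl⟩
          rw [staircaseGap_add hmono]
          exact hmono.monotone (Fin.castSucc_lt_iff_succ_le.1 hj)
        · rwa [Set.image_image]) (by simp) f (by simpa [Fintype.linearCombination_apply] using hf)
    exact ⟨q, by rw [Fintype.linearCombination_apply, hq]⟩

theorem ker_staircaseRelation_eq_bot {n : ℕ} (u : Fin (n + 1) → (Fin 2 →₀ ℕ)) :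
    LinearMap.ker (Fintype.linearCombination (MvPolynomial (Fin 2) K) (staircaseRelation
      (fun i => (X 0 : MvPolynomial (Fin 2) K) ^ staircaseGap u i)
      fun i => X 1 ^ staircaseGap u i)) = ⊥ := by
  rw [LinearMap.ker_eq_bot']
  intro q hq
  rw [Fintype.linearCombination_apply] at hq
  exact staircaseRelation_injective _ _ (fun i => pow_ne_zero _ (X_ne_zero 0)) q hq

/-- The Hilbert–Burch resolution of an ideal generated by monomials of degree `d` in two
variables: the syzygies are generated by the relations between consecutive generators. -/
noncomputable def staircaseResolution {n d : ℕ} {I : Ideal (MvPolynomial (Fin 2) K)}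
    (u : Fin (n + 1) → (Fin 2 →₀ ℕ)) (hmono : StrictMono fun i => u i 0)
    (hdeg : ∀ i, u i 0 + u i 1 = d)
    (hI : I = Ideal.span (Set.range fun i => monomial (u i) (1 : K))) :
    MinimalGradedFreeResolution I where
  rank
    | 0 => n + 1
    | 1 => n
    | _ + 2 => 0
  shift
    | 0 => fun _ => d
    | 1 => fun i => d + staircaseGap u i
    | _ + 2 => Fin.elim0
  aug := Fintype.linearCombination (MvPolynomial (Fin 2) K) fun i => monomial (u i) (1 : K)
  diff
    | 0 => Fintype.linearCombination (MvPolynomial (Fin 2) K) (staircaseRelation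
        (fun i => X 0 ^ staircaseGap u i) fun i => X 1 ^ staircaseGap u i)
    | 1 => 0
    | _ + 2 => 0
  aug_homogeneous k s hs := by
    have hs' : s ∈ (monomial (u k) (1 : K)).support := by simpa using hs
    rw [Finset.mem_singleton.1 (support_monomial_subset hs'), degree_eq_add_of_fin_two, hdeg]
  diff_homogeneous := by
    rintro (_ | _ | i) k
    · intro j s hs
      have hs' : s ∈ (staircaseRelation (fun i => (X 0 : MvPolynomial (Fin 2) K) ^
          staircaseGap u i) (fun i => X 1 ^ staircaseGap u i) k j).support := by simpa using hs
      have hX (i : Fin 2) (h : s ∈ ((X i : MvPolynomial (Fin 2) K) ^ staircaseGap u k).support) :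
          s.degree = staircaseGap u k := by
        rw [X_pow_eq_monomial] at h
        rw [Finset.mem_singleton.1 (support_monomial_subset h), Finsupp.degree_single]
      have hs'' : s.degree = staircaseGap u k := by
        classical
        rw [staircaseRelation, Pi.sub_apply] at hs'
        rcases Finset.mem_union.1 (support_sub _ _ _ hs') with h | h
        · rw [Pi.single_apply] at h
          split_ifs at h
          · exact hX 0 h
          · simp at h
        · rw [Pi.single_apply] at h
          split_ifs at h
          · exact hX 1 h
          · simp at h
      change (s.degree : ℤ) + d = d + staircaseGap u k
      omega
    · exact k.elim0
    · exact k.elim0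
  range_aug := by
    rw [Fintype.range_linearCombination, hI]
  exact_zero := range_staircaseRelation_eq_ker hmono hdeg
  exact_succ := by
    rintro (_ | i)
    · rw [LinearMap.range_zero]
      exact (ker_staircaseRelation_eq_bot u).symm
    · ext w
      have hw : w = 0 := funext fun k => Fin.elim0 k
      rw [hw]
      exact ⟨fun _ => zero_mem _, fun _ => zero_mem _⟩
  minimal := by
    rintro (_ | _ | i) w k
    · rw [Fintype.linearCombination_apply, Finset.sum_apply]
      refine Submodule.sum_mem _ fun i _ => ?_
      rw [Pi.smul_apply, smul_eq_mul]
      refine Ideal.mul_mem_left _ _ ?_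
      have hX (j : Fin 2) : (X j : MvPolynomial (Fin 2) K) ^ staircaseGap u i ∈
          Ideal.span (Set.range (X : Fin 2 → MvPolynomial (Fin 2) K)) :=
        Ideal.pow_mem_of_mem _ (Ideal.subset_span (Set.mem_range_self j)) _ (staircaseGap_pos hmono i)
      rw [staircaseRelation, Pi.sub_apply, Pi.single_apply, Pi.single_apply]
      refine sub_mem ?_ ?_
      · split_ifs
        · exact hX 0
        · exact zero_mem _
      · split_ifs
        · exact hX 1
        · exact zero_mem _
    · exact zero_mem _
    · exact k.elim0
  finite_length := ⟨1, by
    rintro (_ | _ | i) hi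
    · omega
    · omega
    · rfl⟩

theorem MinimalGradedFreeResolution.shift_sub_le_regularity {σ : Type*}
    {I : Ideal (MvPolynomial σ K)} (F : MinimalGradedFreeResolution I) (i : ℕ)
    (k : Fin (F.rank i)) : (((F.shift i k - i : ℤ) : ℝ) : EReal) ≤ regularity I := by
  have h : F.betti i (F.shift i k) ≠ 0 := by
    have : Nonempty {l : Fin (F.rank i) // F.shift i l = F.shift i k} := ⟨⟨k, rfl⟩⟩
    exact Fintype.card_ne_zero
  exact le_iSup_of_le F (le_iSup_of_le i (le_iSup₂_of_le (F.shift i k) h le_rfl))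

theorem regularity_le {σ : Type*} {I : Ideal (MvPolynomial σ K)} {r : ℤ}
    (h : ∀ (F : MinimalGradedFreeResolution I) (i : ℕ) (k : Fin (F.rank i)),
      F.shift i k - i ≤ r) : regularity I ≤ ((r : ℝ) : EReal) := by
  refine iSup_le fun F => iSup_le fun i => iSup₂_le fun j hj => ?_
  obtain ⟨⟨k, rfl⟩⟩ : Nonempty {l : Fin (F.rank i) // F.shift i l = j} :=
    Fintype.card_pos_iff.1 (Nat.pos_of_ne_zero hj)
  exact_mod_cast h F i k

/-- The gap `g` at a pair of consecutive generators contributes `d + g - 1` to the regularity of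
the Hilbert–Burch resolution; if all gaps are one, its degrees bound those of every resolution. -/
theorem regularity_eq_iff_staircaseGap {n d : ℕ} {I : Ideal (MvPolynomial (Fin 2) K)}
    (u : Fin (n + 1) → (Fin 2 →₀ ℕ)) (hmono : StrictMono fun i => u i 0)
    (hdeg : ∀ i, u i 0 + u i 1 = d)
    (hI : I = Ideal.span (Set.range fun i => monomial (u i) (1 : K))) :
    regularity I = ((d : ℝ) : EReal) ↔ ∀ i, staircaseGap u i = 1 := by
  set G := staircaseResolution u hmono hdeg hI with hG
  constructor
  · intro h i
    have h1 := G.shift_sub_le_regularity 1 i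
    have h2 : G.shift 1 i = d + staircaseGap u i := rfl
    rw [h, h2, EReal.coe_le_coe_iff] at h1
    have h3 : (d + staircaseGap u i - (1 : ℕ) : ℤ) ≤ d := by exact_mod_cast h1
    have h4 := staircaseGap_pos hmono i
    omega
  · intro hgap
    refine le_antisymm ?_ ?_
    · have hle : regularity I ≤ (((d : ℤ) : ℝ) : EReal) := by
        refine regularity_le fun F i k => ?_
        have h0 (k) : G.shift 0 k ≤ d := le_refl (d : ℤ)
        have h1 (k) : G.shift 1 k ≤ d + 1 := by
          have h2 : G.shift 1 k = d + staircaseGap u k := rfl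
          have h3 : staircaseGap u k = 1 := hgap k
          omega
        match i, k with
        | 0, k => simpa using F.shift_zero_le G h0 k
        | 1, k => simpa using F.shift_one_le G h0 h1 (by omega) k
        | i + 2, k =>
          rw [F.rank_add_two_eq_zero G rfl i] at k
          exact k.elim0
      simpa using hle
    · have h0 := G.shift_sub_le_regularity 0 (0 : Fin (n + 1))
      have h1 : G.shift 0 (0 : Fin (n + 1)) = d := rfl
      rw [h1] at h0
      simpa using h0

end Resolution

/-! ### Linear quotients -/

section LinearQuotients

variable {K : Type*} [Field K]

theorem IsMonomialIdeal.eq_span_minimalMonomialGenerators {σ : Type*} [Finite σ]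
    {I : Ideal (MvPolynomial σ K)} (hI : IsMonomialIdeal I) :
    I = Ideal.span ((fun a => monomial a (1 : K)) '' minimalMonomialGenerators I) := by
  refine le_antisymm ?_ (Ideal.span_le.2 ?_)
  · obtain ⟨A, hA⟩ := hI
    have hAI (a) (ha : a ∈ A) : monomial a (1 : K) ∈ I := by
      rw [hA]
      exact Ideal.subset_span ⟨a, ha, rfl⟩
    have hle : Ideal.span ((fun a => monomial a (1 : K)) '' A) ≤
        Ideal.span ((fun a => monomial a (1 : K)) '' minimalMonomialGenerators I) := by
      refine Ideal.span_le.2 ?_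
      rintro _ ⟨a, ha, rfl⟩
      obtain ⟨b, hba, hb⟩ := exists_minimal_le_of_wellFoundedLT
        (fun b => monomial b (1 : K) ∈ I) a (hAI a ha)
      refine mem_ideal_span_monomial_image.2 fun s hs => ⟨b, hb, ?_⟩
      rwa [Finset.mem_singleton.1 (support_monomial_subset hs)]
    rwa [← hA] at hle
  · rintro _ ⟨a, ha, rfl⟩
    exact Minimal.prop (P := fun b => monomial b (1 : K) ∈ I) ha

/-- If all gaps are one, then the given order of the generators has linear quotients: each colon
ideal is generated by the second variable. -/
theorem hasLinearQuotients_of_staircaseGap {n d : ℕ} {I : Ideal (MvPolynomial (Fin 2) K)}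
    (u : Fin (n + 1) → (Fin 2 →₀ ℕ)) (hG : Set.range u = minimalMonomialGenerators I)
    (hmono : StrictMono fun i => u i 0) (hdeg : ∀ i, u i 0 + u i 1 = d)
    (hgap : ∀ i, staircaseGap u i = 1) : HasLinearQuotients I := by
  refine ⟨n + 1, u, fun i j hij => hmono.injective (congrArg (· 0) hij), hG, fun i hi => ⟨{1}, ?_⟩⟩
  rw [Set.image_singleton]
  ext f
  rw [Submodule.mem_colon_singleton, smul_eq_mul, Ideal.mem_span_singleton]
  constructor
  · intro hf
    have hf' : f * monomial (u i) (1 : K) ∈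
        Ideal.span ((fun a => monomial a (1 : K)) '' (u '' {j | j < i})) := by
      rwa [Set.image_image]
    rw [← pow_one (X 1)]
    refine X_pow_dvd_of_mul_mem ?_ hf'
    rintro _ ⟨j, hj, rfl⟩
    have h1 : u j 0 < u i 0 := hmono hj
    have h2 := hdeg i
    have h3 := hdeg j
    omega
  · rintro ⟨g, rfl⟩
    obtain ⟨j, rfl⟩ : ∃ j : Fin n, j.succ = i := ⟨i.pred (Fin.pos_iff_ne_zero.1 hi), by simp⟩
    have hrel := staircase_relation (K := K) hmono hdeg j
    rw [hgap, pow_one, pow_one] at hrel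
    rw [mul_right_comm, ← hrel]
    refine Ideal.mul_mem_right _ _ (Ideal.mul_mem_left _ _ (Ideal.subset_span ?_))
    exact ⟨j.castSucc, j.castSucc_lt_succ, rfl⟩

/-- A linear colon ideal puts each generator next to one of its predecessors. -/
theorem exists_adjacent_of_colon_eq {m d : ℕ} {v : Fin m → (Fin 2 →₀ ℕ)}
    (hdeg : ∀ i, v i 0 + v i 1 = d) {i : Fin m} (hi : 0 < (i : ℕ)) {A : Set (Fin 2)}
    (hA : Submodule.colon
        (Ideal.span ((fun j => monomial (v j) (1 : K)) '' {j | j < i}))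
        {monomial (v i) (1 : K)} = Ideal.span (X '' A)) :
    ∃ j < i, v j 0 ≤ v i 0 + 1 ∧ v i 0 ≤ v j 0 + 1 := by
  obtain ⟨l, hl⟩ : A.Nonempty := by
    by_contra hne
    rw [Set.not_nonempty_iff_eq_empty.1 hne, Set.image_empty, Ideal.span_empty] at hA
    -- The colon ideal contains every earlier generator.
    have hmem : monomial (v ⟨0, hi.trans i.2⟩) (1 : K) ∈ Submodule.colon
        (Ideal.span ((fun j => monomial (v j) (1 : K)) '' {j | j < i}))
        {monomial (v i) (1 : K)} := by
      rw [Submodule.mem_colon_singleton]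
      exact Ideal.mul_mem_right _ _ (Ideal.subset_span ⟨⟨0, hi.trans i.2⟩, hi, rfl⟩)
    rw [hA, Ideal.mem_bot, monomial_eq_zero] at hmem
    exact one_ne_zero hmem
  have hX : (X l : MvPolynomial (Fin 2) K) ∈ Ideal.span (X '' A) := Ideal.subset_span ⟨l, hl, rfl⟩
  rw [← hA, Submodule.mem_colon_singleton, smul_eq_mul, X, monomial_mul, one_mul,
    ← Set.image_image (fun a => monomial a (1 : K)), mem_ideal_span_monomial_image] at hX
  obtain ⟨_, ⟨j, hj, rfl⟩, hle⟩ := hX (Finsupp.single l 1 + v i) (by simp)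
  refine ⟨j, hj, ?_⟩
  have h0 := hle 0
  have h1 := hle 1
  have h2 := hdeg i
  have h3 := hdeg j
  fin_cases l <;> simp at h0 h1 <;> omega

/-- In an ordering with linear quotients the generators never cross a gap of size at least two. -/
theorem staircaseGap_eq_one_of_hasLinearQuotients {n d : ℕ} {I : Ideal (MvPolynomial (Fin 2) K)}
    (u : Fin (n + 1) → (Fin 2 →₀ ℕ)) (hG : Set.range u = minimalMonomialGenerators I)
    (hmono : StrictMono fun i => u i 0) (hdeg : ∀ i, u i 0 + u i 1 = d)
    (h : HasLinearQuotients I) (i : Fin n) : staircaseGap u i = 1 := by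
  obtain ⟨m, v, -, hrange, hcolon⟩ := h
  rw [← hG] at hrange
  have hvu (k) : ∃ j, u j = v k := by
    have : v k ∈ Set.range u := hrange ▸ ⟨k, rfl⟩
    exact this
  have huv (j) : ∃ k, v k = u j := by
    have : u j ∈ Set.range v := hrange ▸ ⟨j, rfl⟩
    exact this
  have hvdeg (k) : v k 0 + v k 1 = d := by
    obtain ⟨j, hj⟩ := hvu k
    rw [← hj, hdeg]
  by_contra hne
  have hpos := staircaseGap_pos hmono i
  have hadd := staircaseGap_add hmono i
  -- Each generator lies on one side of the gap between the generators `i` and `i + 1`.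
  have hside (k) : v k 0 ≤ u i.castSucc 0 ∨ u i.succ 0 ≤ v k 0 := by
    obtain ⟨j, hj⟩ := hvu k
    rw [← hj]
    rcases le_or_gt j i.castSucc with h | h
    · exact Or.inl (hmono.monotone h)
    · exact Or.inr (hmono.monotone (Fin.castSucc_lt_iff_succ_le.1 h))
  have hall (b : ℕ) (hb : b < m) :
      (v ⟨0, by omega⟩ 0 ≤ u i.castSucc 0 ↔ v ⟨b, hb⟩ 0 ≤ u i.castSucc 0) := by
    induction b using Nat.strong_induction_on with
    | _ b ih =>
      rcases Nat.eq_zero_or_pos b with rfl | hb0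
      · rfl
      · obtain ⟨A, hA⟩ := hcolon ⟨b, hb⟩ hb0
        obtain ⟨j, hj, h1, h2⟩ := exists_adjacent_of_colon_eq hvdeg hb0 hA
        rw [ih j hj j.2]
        have h3 := hside j
        have h4 := hside ⟨b, hb⟩
        rw [Fin.eta]
        omega
  obtain ⟨k, hk⟩ := huv i.castSucc
  obtain ⟨l, hl⟩ := huv i.succ
  have h1 := hall k k.2
  have h2 := hall l l.2
  rw [Fin.eta] at h1 h2
  rw [hk] at h1
  rw [hl] at h2
  omega

end LinearQuotients

theorem lemma3p3 {K : Type*} [Field K] (I : Ideal (MvPolynomial (Fin 2) K))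
    (hI : IsMonomialIdeal I) (m d : ℕ) (hm : 1 ≤ m) (u : Fin m → (Fin 2 →₀ ℕ))
    (hG : Set.range u = minimalMonomialGenerators I)
    (hmono : StrictMono fun i => u i 0)
    (hdeg : ∀ i, u i 0 + u i 1 = d) :
    (regularity I = ((d : ℝ) : EReal) ↔
      m = 1 ∨ (2 ≤ m ∧ ∀ (i : ℕ) (h : i + 1 < m),
        ((u ⟨i + 1, h⟩ 0 : ℕ) : ℤ) - ((u ⟨i, Nat.lt_of_succ_lt h⟩ 0 : ℕ) : ℤ) = 1)) ∧
    (regularity I = ((d : ℝ) : EReal) ↔ HasLinearQuotients I) := by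
  obtain ⟨n, rfl⟩ : ∃ n, m = n + 1 := ⟨m - 1, by omega⟩
  have hspan : I = Ideal.span (Set.range fun i => monomial (u i) (1 : K)) := by
    rw [Set.range_comp' (fun a => monomial a (1 : K)) u, hG]
    exact hI.eq_span_minimalMonomialGenerators
  rw [regularity_eq_iff_staircaseGap u hmono hdeg hspan]
  refine ⟨⟨fun h => ?_, fun h i => ?_⟩, fun h => ?_, fun h i => ?_⟩
  · rcases Nat.eq_zero_or_pos n with rfl | hn
    · exact Or.inl rfl
    · refine Or.inr ⟨by omega, fun i hi => ?_⟩
      have h1 := staircaseGap_add hmono (⟨i, by omega⟩ : Fin n)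
      rw [h, Fin.succ_mk, Fin.castSucc_mk] at h1
      omega
  · have hi := i.2
    rcases h with h | ⟨-, h⟩
    · omega
    · have h1 := staircaseGap_add hmono i
      have h2 := h i (by omega)
      change ((u i.succ 0 : ℕ) : ℤ) - ((u i.castSucc 0 : ℕ) : ℤ) = 1 at h2
      omega
  · exact hasLinearQuotients_of_staircaseGap u hG hmono hdeg h
  · exact staircaseGap_eq_one_of_hasLinearQuotients u hG hmono hdeg h i
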